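/- For $0<\varepsilon<1$ let $A_1,A_2$ be two copies of the closed flat annulus $\{x\in\mathbb{R}^2:\varepsilon\le|x|\le1\}$; for $x$ in the annulus write $x_1\in A_1$ and $x_2\in A_2$ for its two copies. Glue $A_1$ and $A_2$ along the inner circle (that is, $x_1\sim x_2$ whenever $|x|=\varepsilon$), and let $M_\varepsilon$ be the quotient of the resulting doubled annulus by the involution $\iota(x_1)=(-x)_2$, $\iota(x_2)=(-x)_1$. This is a Möbius band; it carries the metric $\xi$ induced by the Euclidean metric of the annuli, which is Lipschitz across the image of the inner circle and flat elsewhere, and its boundary is the image of the unit circles. Let $\mathcal{C}(M_\varepsilon)$ be the space of continuous functions on $M_\varepsilon$ whose pullbacks to $A_1$ and to $A_2$ are $\mathcal{C}^\infty$ up to the boundary, and let $$\sigma_1(M_\varepsilon,\xi)=\inf_{\substack{V\subset\mathcal{C}(M_\varepsilon)\\ \dim V=2}}\ \max_{\phi\in V\setminus\{0\}}\frac{\int_{M_\varepsilon}|\nabla\phi|_\xi^2\,dA_\xi}{\int_{\partial M_\varepsilon}\phi^2\,dL_\xi},\qquad \bar\sigma_1(M_\varepsilon,\xi)=\sigma_1(M_\varepsilon,\xi)\,L_\xi(\partial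 M_\varepsilon)$$ be its first Steklov eigenvalue and its first Steklov eigenvalue normalized by the length of the boundary (a quotient with vanishing denominator and $\phi\neq0$ is $+\infty$). **Proposition.** There is $\varepsilon_0\in(0,1)$ such that for all $0<\varepsilon<\varepsilon_0$ the number $\bar\sigma_1(M_\varepsilon,\xi)$ is finite and $$\bar\sigma_1(M_\varepsilon,\xi)>2\pi.$$ -/

import Mathlib

open scoped ContDiff ENNReal

noncomputable section

namespace FlatMobius

/-- The closed flat annulus of radii `ε` and `1` in the Euclidean plane `ℂ = ℝ²`. -/
def annulus (ε : ℝ) : Set ℂ := {z | ε ≤ ‖z‖ ∧ ‖z‖ ≤ 1}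

/-- The disjoint union of two copies (labelled by `false` and `true`) of the annulus. -/
abbrev TwoSheets (ε : ℝ) : Type := Bool × annulus ε

/-- The gluing along the inner circle: the two copies of a point `z` with `‖z‖ = ε` are
identified, and nothing else is. -/
def doubleSetoid (ε : ℝ) : Setoid (TwoSheets ε) where
  r p q := p.2 = q.2 ∧ (p.1 = q.1 ∨ ‖(p.2 : ℂ)‖ = ε)
  iseqv :=
    { refl := fun _ => ⟨rfl, Or.inl rfl⟩
      symm := by
        rintro p q ⟨h, h'⟩
        refine ⟨h.symm, ?_⟩
        rw [← h]
        exact h'.imp Eq.symm id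
      trans := by
        rintro p q r ⟨h, h'⟩ ⟨k, k'⟩
        refine ⟨h.trans k, ?_⟩
        rw [← h] at k'
        rcases h' with h' | h'
        · exact k'.imp h'.trans id
        · exact Or.inr h' }

/-- The annulus doubled along its inner circle. -/
abbrev DoubledAnnulus (ε : ℝ) : Type := Quotient (doubleSetoid ε)

/-- The antipodal map of the annulus. -/
def antipode {ε : ℝ} (z : annulus ε) : annulus ε :=
  ⟨-(z : ℂ), by simpa [annulus] using z.2⟩

theorem antipode_antipode {ε : ℝ} (z : annulus ε) : antipode (antipode z) = z :=
  Subtype.ext (neg_neg _)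

/-- The involution of the doubled annulus that sends a point of one copy to the antipodal point
of the other copy. -/
def involution {ε : ℝ} : DoubledAnnulus ε → DoubledAnnulus ε :=
  Quotient.map (fun p : TwoSheets ε => ((!p.1, antipode p.2) : TwoSheets ε)) (by
    rintro p q ⟨h, h'⟩
    refine ⟨congrArg antipode h, ?_⟩
    rcases h' with h' | h'
    · exact Or.inl (congrArg Bool.not h')
    · exact Or.inr (by simpa [antipode] using h'))

theorem involution_involution {ε : ℝ} (p : DoubledAnnulus ε) :
    involution (involution p) = p := by
  induction p using Quotient.inductionOn with
  | h p =>
    change (Quotient.mk (doubleSetoid ε) (!!p.1, antipode (antipode p.2)) : DoubledAnnulus ε) = _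
    rw [Bool.not_not, antipode_antipode]

/-- The orbit relation of the involution. -/
def mobiusSetoid (ε : ℝ) : Setoid (DoubledAnnulus ε) where
  r p q := p = q ∨ involution p = q
  iseqv :=
    { refl := fun _ => Or.inl rfl
      symm := by
        rintro p q (h | h)
        · exact Or.inl h.symm
        · exact Or.inr (by rw [← h, involution_involution])
      trans := by
        rintro p q r (rfl | rfl) (rfl | rfl)
        · exact Or.inl rfl
        · exact Or.inr rfl
        · exact Or.inr rfl
        · exact Or.inl (involution_involution p).symm }

/-- The Möbius band: the doubled annulus modulo the involution, with the quotient topology. -/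
abbrev MobiusBand (ε : ℝ) : Type := Quotient (mobiusSetoid ε)

/-- The projection of the sheet labelled `i` to the Möbius band. -/
def sheet {ε : ℝ} (i : Bool) (z : annulus ε) : MobiusBand ε :=
  Quotient.mk (mobiusSetoid ε) (Quotient.mk (doubleSetoid ε) (i, z))

open Classical in
/-- A function on the Möbius band read on the sheet `i`, as a function on the closed annulus.
The value `0` outside the annulus is never used. -/
def pullback {ε : ℝ} (i : Bool) (φ : MobiusBand ε → ℝ) (z : ℂ) : ℝ :=
  if h : z ∈ annulus ε then φ (sheet i ⟨z, h⟩) else 0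

theorem pullback_add {ε : ℝ} (i : Bool) (φ ψ : MobiusBand ε → ℝ) :
    pullback i (φ + ψ) = pullback i φ + pullback i ψ := by
  funext z
  by_cases h : z ∈ annulus ε <;> simp [pullback, h]

theorem pullback_smul {ε : ℝ} (i : Bool) (c : ℝ) (φ : MobiusBand ε → ℝ) :
    pullback i (c • φ) = c • pullback i φ := by
  funext z
  by_cases h : z ∈ annulus ε <;> simp [pullback, h]

/-- The test functions: continuous functions on the Möbius band that are smooth, up to the
boundary, on each of the two closed sheets. -/
def testFunctions (ε : ℝ) : Submodule ℝ (MobiusBand ε → ℝ) where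
  carrier := {φ | Continuous φ ∧ ∀ i, ContDiffOn ℝ ∞ (pullback i φ) (annulus ε)}
  zero_mem' := by
    refine ⟨continuous_const, fun i => ?_⟩
    have h : pullback i (0 : MobiusBand ε → ℝ) = fun _ => 0 := by
      funext z
      simp [pullback]
    rw [h]
    exact contDiffOn_const
  add_mem' := by
    rintro φ ψ ⟨h1, h2⟩ ⟨k1, k2⟩
    refine ⟨h1.add k1, fun i => ?_⟩
    rw [pullback_add]
    exact (h2 i).add (k2 i)
  smul_mem' := by
    rintro c φ ⟨h1, h2⟩
    refine ⟨h1.const_smul c, fun i => ?_⟩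
    rw [pullback_smul]
    exact (h2 i).const_smul c

/-- The Dirichlet energy of `φ` on the Möbius band for the flat metric. The involution exchanges
the two sheets isometrically, so either one is a fundamental domain; the boundary circles of the
sheet have area zero and are left out. -/
def dirichletEnergy {ε : ℝ} (φ : MobiusBand ε → ℝ) : ℝ≥0∞ :=
  ∫⁻ z in {z : ℂ | ε < ‖z‖ ∧ ‖z‖ < 1}, ENNReal.ofReal (‖gradient (pullback false φ) z‖ ^ 2)

/-- The integral of a non-negative function over the boundary of the Möbius band with respect to
arc length. The boundary is the image of the unit circle of either sheet, parametrized there by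
arc length as `θ ↦ exp (i θ)`. -/
def boundaryIntegral {ε : ℝ} (f : MobiusBand ε → ℝ) : ℝ≥0∞ :=
  ∫⁻ θ in Set.Ioc (0 : ℝ) (2 * Real.pi), ENNReal.ofReal (pullback false f (circleMap 0 1 θ))

/-- The length of the boundary of the Möbius band. -/
def boundaryLength (ε : ℝ) : ℝ≥0∞ := boundaryIntegral (fun _ : MobiusBand ε => 1)

/-- The `k`-th Steklov eigenvalue of the flat Möbius band: the infimum over the
`(k+1)`-dimensional spaces of test functions of the largest Rayleigh quotient. A non-zero `φ` that
vanishes on the boundary has Rayleigh quotient `⊤`. -/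
def steklovEigenvalue (ε : ℝ) (k : ℕ) : ℝ≥0∞ :=
  ⨅ (V : Submodule ℝ (MobiusBand ε → ℝ)) (_ : V ≤ testFunctions ε)
    (_ : Module.finrank ℝ V = k + 1),
    ⨆ (φ : MobiusBand ε → ℝ) (_ : φ ∈ V) (_ : φ ≠ 0),
      dirichletEnergy φ / boundaryIntegral (fun p => φ p ^ 2)

/-- The `k`-th Steklov eigenvalue normalized by the length of the boundary. -/
def normalizedSteklovEigenvalue (ε : ℝ) (k : ℕ) : ℝ≥0∞ :=
  steklovEigenvalue ε k * boundaryLength ε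

end FlatMobius

end

/-! One sheet is a fundamental domain, so a function on the Möbius band is a function `u` on the
annulus, and the gluing forces `u (-z) = u z` on the inner circle (`pullback_neg`). Split `u` on
each circle into its odd and even parts under `θ ↦ θ + π`. The odd part has frequencies at least 1
and vanishes on the inner circle. The even part has mean-free frequencies at least 2 and is
unconstrained there. The Dirichlet condition lifts the odd modes above the value 1 of the disk; for
small `ε` the even modes stay near 2.

This is made quantitative without separating variables. If `r P' = k² - P²`, completing a square and
Wirtinger's inequality bound the energy of a strip below by the increment of `P` times the variance
on circles (`riccati_energy_bound`). With explicit solutions for `k = 1` and `k = 2` the inner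
boundary term vanishes and the outer one dominates the `L²` norm of a mean-zero boundary value. Thus
`steklovBound_mul_le` holds with a constant larger than 1.

Every two-dimensional test space contains a nonzero function of boundary mean zero, so the
eigenvalue exceeds 1, while the boundary has length `2π`. Finiteness follows from the space spanned
by `1` and `Re z²`. -/

noncomputable section

namespace FlatMobius

open MeasureTheory intervalIntegral Set Filter Topology

/-! ### Wirtinger's inequality and the Riccati bound on a strip -/

/-- Wirtinger's inequality on an interval with periodic boundary conditions. -/
theorem wirtinger {T : ℝ} (hT : 0 < T) {g g' : ℝ → ℝ} (hg' : Continuous g')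
    (hd : ∀ x, HasDerivAt g (g' x) x) (hper : g T = g 0) :
    (2 * Real.pi / T) ^ 2 * ((∫ x in 0..T, g x ^ 2) - (∫ x in 0..T, g x) ^ 2 / T) ≤
      ∫ x in 0..T, g' x ^ 2 := by
  have hg : Continuous g := continuous_iff_continuousAt.2 fun x => (hd x).continuousAt
  have memLp : ∀ h : ℝ → ℝ, Continuous h →
      MemLp (fun x => (h x : ℂ)) 2 (volume.restrict (Ioc 0 T)) := by
    intro h hh
    have h1 : Continuous fun x => (h x : ℂ) := Complex.continuous_ofReal.comp hh
    obtain ⟨C, hC⟩ := (isCompact_Icc (a := (0 : ℝ)) (b := T)).exists_bound_of_continuousOn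
      h1.continuousOn
    refine MemLp.of_bound h1.aestronglyMeasurable C ?_
    filter_upwards [ae_restrict_mem measurableSet_Ioc] with x hx
    exact hC x (Ioc_subset_Icc_self hx)
  have S := hasSum_sq_fourierCoeffOn hT (memLp g hg)
  have S' := hasSum_sq_fourierCoeffOn hT (memLp g' hg')
  have coeff : ∀ n : ℤ, n ≠ 0 → (2 * Real.pi / T) ^ 2 *
      ‖fourierCoeffOn hT (fun x => (g x : ℂ)) n‖ ^ 2 ≤
        ‖fourierCoeffOn hT (fun x => (g' x : ℂ)) n‖ ^ 2 := by
    intro n hn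
    -- Integration by parts has no boundary term by periodicity, so differentiation multiplies the
    -- coefficient by `2πin/T`, and `|n| ≥ 1`.
    rw [fourierCoeffOn_of_hasDerivAt hT hn (f' := fun x => (g' x : ℂ))
      (fun x _ => (hd x).ofReal_comp)
      ((Complex.continuous_ofReal.comp hg').intervalIntegrable _ _), hper]
    have h1 : (1 : ℝ) ≤ (n : ℝ) ^ 2 := by
      have : (1 : ℤ) ≤ n ^ 2 := by have := sq_pos_of_ne_zero hn; omega
      exact_mod_cast this
    have h3 : |T| ^ 2 = T ^ 2 := sq_abs T
    have h4 : |(n : ℝ)| ^ 2 = (n : ℝ) ^ 2 := sq_abs _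
    have h5 : |Real.pi| = Real.pi := abs_of_pos Real.pi_pos
    simp only [sub_self, mul_zero, zero_sub, norm_mul, norm_neg, norm_div, norm_one,
      Complex.ofReal_zero, sub_zero, Complex.norm_real, Complex.norm_I, Complex.norm_intCast,
      Complex.norm_ofNat, Real.norm_eq_abs, mul_one, mul_pow, div_pow, h3, h4, h5, one_pow]
    have hpi := Real.pi_pos
    rw [show (2 ^ 2 * Real.pi ^ 2 / T ^ 2 * (1 / (2 ^ 2 * Real.pi ^ 2 * (n : ℝ) ^ 2) *
      (T ^ 2 * ‖fourierCoeffOn hT (fun x => (g' x : ℂ)) n‖ ^ 2)) : ℝ) =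
      ‖fourierCoeffOn hT (fun x => (g' x : ℂ)) n‖ ^ 2 / (n : ℝ) ^ 2 by field_simp]
    exact div_le_self (sq_nonneg _) h1
  have zeroth : ‖fourierCoeffOn hT (fun x => (g x : ℂ)) 0‖ ^ 2 =
      (∫ x in 0..T, g x) ^ 2 / T ^ 2 := by
    rw [fourierCoeffOn_eq_integral]
    simp only [neg_zero, fourier_zero, one_smul, sub_zero, intervalIntegral.integral_ofReal,
      norm_smul, Complex.norm_real, Real.norm_eq_abs, mul_pow, sq_abs]
    ring
  -- Removing the zeroth term from Parseval's sum turns the `L²` norm into the variance.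
  have S2 := (S.sub (hasSum_ite_eq (0 : ℤ) (‖fourierCoeffOn hT (fun x => (g x : ℂ)) 0‖ ^ 2))).mul_left
    ((2 * Real.pi / T) ^ 2)
  have key := hasSum_le (fun n => ?_) S2 S'
  · rw [zeroth] at key
    simp only [sub_zero, smul_eq_mul, Complex.norm_real, Real.norm_eq_abs, sq_abs] at key
    have := mul_le_mul_of_nonneg_left key hT.le
    calc _ = T * ((2 * Real.pi / T) ^ 2 * (T⁻¹ * (∫ x in 0..T, g x ^ 2) -
            (∫ x in 0..T, g x) ^ 2 / T ^ 2)) := by field_simp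
      _ ≤ _ := this
      _ = _ := by field_simp
  · by_cases hn : n = 0
    · subst hn
      simp
    · simpa [hn] using coeff n hn

theorem hasDerivAt_integral_of_continuous {F F' : ℝ → ℝ → ℝ} (hF : Continuous ↿F)
    (hF' : Continuous ↿F') {s t : ℝ} (hd : ∀ r ∈ Ioo s t, ∀ θ, HasDerivAt (F · θ) (F' r θ) r)
    (a b : ℝ) {r : ℝ} (hr : r ∈ Ioo s t) :
    HasDerivAt (fun r => ∫ θ in a..b, F r θ) (∫ θ in a..b, F' r θ) r := by
  obtain ⟨C, hC⟩ := ((isCompact_Icc (a := s) (b := t)).prod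
    (isCompact_uIcc (a := a) (b := b))).exists_bound_of_continuousOn hF'.continuousOn
  have c : ∀ r, Continuous (F r) := fun r => hF.comp (by fun_prop : Continuous fun θ => (r, θ))
  have c' : ∀ r, Continuous (F' r) := fun r => hF'.comp (by fun_prop : Continuous fun θ => (r, θ))
  refine (hasDerivAt_integral_of_dominated_loc_of_deriv_le (bound := fun _ => C)
    (Ioo_mem_nhds hr.1 hr.2) (.of_forall fun r => (c r).aestronglyMeasurable)
    ((c r).intervalIntegrable _ _) (c' r).aestronglyMeasurable (.of_forall fun θ hθ r hr => ?_)
    intervalIntegrable_const (.of_forall fun θ _ r hr => hd r hr θ)).2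
  exact hC (r, θ) ⟨Ioo_subset_Icc_self hr, uIoc_subset_uIcc hθ⟩

theorem continuous_integral_of_continuous {F : ℝ → ℝ → ℝ} (hF : Continuous ↿F) (a b : ℝ) :
    Continuous fun r => ∫ θ in a..b, F r θ :=
  intervalIntegral.continuous_parametric_intervalIntegral_of_continuous' hF a b

/-- `T` times the variance of `g` on `[0, T]`. -/
def variation (T : ℝ) (g : ℝ → ℝ) : ℝ :=
  (∫ θ in 0..T, g θ ^ 2) - (∫ θ in 0..T, g θ) ^ 2 / T

theorem continuous_variation {F : ℝ → ℝ → ℝ} (hF : Continuous ↿F) (T : ℝ) :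
    Continuous fun r => variation T (F r) := by
  have h1 := continuous_integral_of_continuous (F := fun r θ => F r θ ^ 2)
    (hF.pow 2) 0 T
  exact h1.sub (((continuous_integral_of_continuous hF 0 T).pow 2).div_const T)

/-- The lower bound of the Dirichlet energy of a strip, in polar coordinates, by a solution of the
Riccati equation. -/
theorem riccati_energy_bound {f fr fθ : ℝ → ℝ → ℝ} (hf : Continuous ↿f) (hfr : Continuous ↿fr)
    (hfθ : Continuous ↿fθ) {s t T : ℝ} (hs : 0 < s) (hst : s ≤ t) (hT : 0 < T)
    (hdr : ∀ r ∈ Ioo s t, ∀ θ, HasDerivAt (f · θ) (fr r θ) r)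
    (hdθ : ∀ r θ, HasDerivAt (f r) (fθ r θ) θ) (hper : ∀ r, f r T = f r 0)
    {P : ℝ → ℝ} (hPc : ContinuousOn P (Icc s t))
    (hP : ∀ r ∈ Ioo s t, HasDerivAt P (((2 * Real.pi / T) ^ 2 - P r ^ 2) / r) r) :
    P t * variation T (f t) - P s * variation T (f s) ≤
      ∫ r in s..t, (r * (∫ θ in 0..T, fr r θ ^ 2) + (∫ θ in 0..T, fθ r θ ^ 2) / r) := by
  have sq : ∀ {F : ℝ → ℝ → ℝ}, Continuous ↿F → Continuous ↿(fun r θ => F r θ ^ 2) :=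
    fun h => h.pow 2
  have sec : ∀ {F : ℝ → ℝ → ℝ}, Continuous ↿F → ∀ r, Continuous (F r) :=
    fun h r => h.comp (by fun_prop : Continuous fun θ => (r, θ))
  have mulc : Continuous ↿(fun r θ => 2 * f r θ * fr r θ) :=
    (continuous_const.mul hf).mul hfr
  refine sub_le_integral_of_hasDeriv_right_of_le (g := fun r => P r * variation T (f r))
    (g' := fun r => ((2 * Real.pi / T) ^ 2 - P r ^ 2) / r * variation T (f r) +
      P r * ((∫ θ in 0..T, 2 * f r θ * fr r θ) -
        2 * (∫ θ in 0..T, f r θ) * (∫ θ in 0..T, fr r θ) / T)) hst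
    (hPc.mul (continuous_variation hf T).continuousOn) (fun r hr => ?_) ?_ (fun r hr => ?_)
  · have d1 := hasDerivAt_integral_of_continuous (F := fun r θ => f r θ ^ 2)
      (F' := fun r θ => 2 * f r θ * fr r θ) (sq hf) mulc
      (fun r hr θ => by simpa using (hdr r hr θ).fun_pow 2) 0 T hr
    have d2 := hasDerivAt_integral_of_continuous hf hfr hdr 0 T hr
    have d3 := d1.sub ((d2.fun_pow 2).div_const T)
    have := (hP r hr).mul d3
    simp only [Nat.cast_ofNat, Nat.add_one_sub_one, pow_one] at this
    exact this.hasDerivWithinAt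
  · refine ContinuousOn.integrableOn_Icc ?_
    refine (continuous_id.mul (continuous_integral_of_continuous (sq hfr) 0 T)).continuousOn.add ?_
    exact (continuous_integral_of_continuous (sq hfθ) 0 T).continuousOn.div continuousOn_id
      fun r hr => (hs.trans_le hr.1).ne'
  · have hr0 : 0 < r := hs.trans hr.1
    have W := wirtinger hT (sec hfθ r) (hdθ r) (hper r)
    change _ * variation T (f r) ≤ _ at W
    set m := (∫ θ in 0..T, f r θ) / T with hm
    set m' := (∫ θ in 0..T, fr r θ) / T with hm'
    have cf := sec hf r
    have cfr := sec hfr r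
    -- The completed square behind the Riccati equation: its nonnegativity and Wirtinger's
    -- inequality bound the derivative of `P` times the variance. The energy `r ^ 2 * m' ^ 2 * T` of
    -- the circle means is discarded.
    have expand : (∫ θ in 0..T, ((r * (fr r θ - m') - P r * (f r θ - m)) ^ 2)) =
        r ^ 2 * (∫ θ in 0..T, fr r θ ^ 2) - r ^ 2 * m' ^ 2 * T
        - r * P r * ((∫ θ in 0..T, 2 * f r θ * fr r θ) - 2 * m * m' * T)
        + P r ^ 2 * variation T (f r) := by
      have e : ∀ θ, (r * (fr r θ - m') - P r * (f r θ - m)) ^ 2 =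
          r ^ 2 * fr r θ ^ 2 - r * P r * (2 * f r θ * fr r θ) + P r ^ 2 * f r θ ^ 2
          + (2 * r * P r * m - 2 * r ^ 2 * m') * fr r θ
          + (2 * r * P r * m' - 2 * P r ^ 2 * m) * f r θ + (r * m' - P r * m) ^ 2 := by
        intro θ; ring
      simp_rw [e]
      have i1 : IntervalIntegrable (fun θ => r ^ 2 * fr r θ ^ 2) volume 0 T :=
        Continuous.intervalIntegrable (by fun_prop) _ _
      have i2 : IntervalIntegrable (fun θ => r * P r * (2 * f r θ * fr r θ)) volume 0 T :=
        Continuous.intervalIntegrable (by fun_prop) _ _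
      have i3 : IntervalIntegrable (fun θ => P r ^ 2 * f r θ ^ 2) volume 0 T :=
        Continuous.intervalIntegrable (by fun_prop) _ _
      have i4 : IntervalIntegrable (fun θ => (2 * r * P r * m - 2 * r ^ 2 * m') * fr r θ)
        volume 0 T := Continuous.intervalIntegrable (by fun_prop) _ _
      have i5 : IntervalIntegrable (fun θ => (2 * r * P r * m' - 2 * P r ^ 2 * m) * f r θ)
        volume 0 T := Continuous.intervalIntegrable (by fun_prop) _ _
      rw [integral_add ((((i1.sub i2).add i3).add i4).add i5) intervalIntegrable_const,
        integral_add (((i1.sub i2).add i3).add i4) i5, integral_add ((i1.sub i2).add i3) i4,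
        integral_add (i1.sub i2) i3, integral_sub i1 i2]
      simp only [intervalIntegral.integral_const_mul, intervalIntegral.integral_const]
      have a1 : (∫ θ in 0..T, f r θ) = m * T := by rw [hm]; field_simp
      have a2 : (∫ θ in 0..T, fr r θ) = m' * T := by rw [hm']; field_simp
      rw [variation, a1, a2, smul_eq_mul]
      field_simp
      ring
    have nn : 0 ≤ ∫ θ in 0..T, ((r * (fr r θ - m') - P r * (f r θ - m)) ^ 2) :=
      intervalIntegral.integral_nonneg hT.le fun θ _ => sq_nonneg _
    rw [expand] at nn
    have a3 : 2 * (∫ θ in 0..T, f r θ) * (∫ θ in 0..T, fr r θ) / T = 2 * m * m' * T := by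
      rw [hm, hm']; field_simp
    rw [a3]
    set X := (∫ θ in 0..T, 2 * f r θ * fr r θ) - 2 * m * m' * T
    set V := variation T (f r)
    have : 0 ≤ r ^ 2 * m' ^ 2 * T := by positivity
    rw [show ((2 * Real.pi / T) ^ 2 - P r ^ 2) / r * V + P r * X =
      (((2 * Real.pi / T) ^ 2 * V - P r ^ 2 * V) + r * P r * X) / r by field_simp,
      show r * (∫ θ in 0..T, fr r θ ^ 2) + (∫ θ in 0..T, fθ r θ ^ 2) / r =
      (r ^ 2 * (∫ θ in 0..T, fr r θ ^ 2) + (∫ θ in 0..T, fθ r θ ^ 2)) / r by field_simp]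
    exact div_le_div_of_nonneg_right (by linarith) hr0.le

/-! ### Odd and even modes on the circle -/

theorem integral_two_pi_eq {h : ℝ → ℝ} (hh : Continuous h) :
    ∫ θ in 0..2 * Real.pi, h θ = ∫ θ in 0..Real.pi, (h θ + h (θ + Real.pi)) := by
  have c : Continuous fun θ => h (θ + Real.pi) := by fun_prop
  rw [integral_add (hh.intervalIntegrable _ _) (c.intervalIntegrable _ _),
    integral_comp_add_right (fun θ => h θ), zero_add, ← two_mul,
    integral_add_adjacent_intervals (hh.intervalIntegrable _ _) (hh.intervalIntegrable _ _)]

/-- The part of a function on the circle that is odd under the antipodal map. -/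
def oddPart (g : ℝ → ℝ) (θ : ℝ) : ℝ := (g θ - g (θ + Real.pi)) / 2

/-- The part of a function on the circle that is even under the antipodal map. -/
def evenPart (g : ℝ → ℝ) (θ : ℝ) : ℝ := (g θ + g (θ + Real.pi)) / 2

/-- Pairing `θ` with `θ + π` cancels the cross terms. The even part is `π`-periodic, so its
half-circle integral counts twice. -/
theorem integral_oddPart_sq_add_evenPart_sq {g : ℝ → ℝ} (hg : Continuous g)
    (hper : ∀ θ, g (θ + 2 * Real.pi) = g θ) :
    (∫ θ in 0..2 * Real.pi, oddPart g θ ^ 2) + 2 * ∫ θ in 0..Real.pi, evenPart g θ ^ 2 =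
      ∫ θ in 0..2 * Real.pi, g θ ^ 2 := by
  have h : ∀ θ, g (θ + Real.pi + Real.pi) = g θ := fun θ => by
    rw [← hper θ]; congr 1; ring
  unfold oddPart evenPart
  rw [integral_two_pi_eq (by fun_prop), integral_two_pi_eq (by fun_prop),
    ← intervalIntegral.integral_const_mul, ← intervalIntegral.integral_add]
  · refine integral_congr fun θ _ => ?_
    simp only [h]
    ring
  all_goals exact Continuous.intervalIntegrable (by fun_prop) _ _

theorem integral_oddPart {g : ℝ → ℝ} (hg : Continuous g)
    (hper : ∀ θ, g (θ + 2 * Real.pi) = g θ) : ∫ θ in 0..2 * Real.pi, oddPart g θ = 0 := by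
  have h : ∀ θ, g (θ + Real.pi + Real.pi) = g θ := fun θ => by
    rw [← hper θ]; congr 1; ring
  unfold oddPart
  rw [integral_two_pi_eq (by fun_prop)]
  simp only [h]
  ring_nf
  simp

theorem integral_evenPart {g : ℝ → ℝ} (hg : Continuous g) :
    ∫ θ in 0..Real.pi, evenPart g θ = (∫ θ in 0..2 * Real.pi, g θ) / 2 := by
  rw [integral_two_pi_eq hg, ← intervalIntegral.integral_div]
  rfl

theorem continuous_oddPart {F : ℝ → ℝ → ℝ} (hF : Continuous ↿F) :
    Continuous ↿(fun r => oddPart (F r)) := by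
  have : Continuous fun p : ℝ × ℝ => F p.1 (p.2 + Real.pi) :=
    hF.comp (by fun_prop : Continuous fun p : ℝ × ℝ => (p.1, p.2 + Real.pi))
  exact (hF.sub this).div_const 2

theorem continuous_evenPart {F : ℝ → ℝ → ℝ} (hF : Continuous ↿F) :
    Continuous ↿(fun r => evenPart (F r)) := by
  have : Continuous fun p : ℝ × ℝ => F p.1 (p.2 + Real.pi) :=
    hF.comp (by fun_prop : Continuous fun p : ℝ × ℝ => (p.1, p.2 + Real.pi))
  exact (hF.add this).div_const 2

/-- The quadratic form on functions on the circle that bounds the Dirichlet energy: the odd and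
the even modes are weighted by `a` and `b`. -/
def weightedMass (a b : ℝ) (g : ℝ → ℝ) : ℝ :=
  a * variation (2 * Real.pi) (oddPart g) + b * (2 * variation Real.pi (evenPart g))

/-- The Dirichlet energy of a strip bounded below separately on the odd and the even modes. -/
theorem weightedMass_sub_le {f fr fθ : ℝ → ℝ → ℝ} (hf : Continuous ↿f) (hfr : Continuous ↿fr)
    (hfθ : Continuous ↿fθ) {s t : ℝ} (hs : 0 < s) (hst : s ≤ t)
    (hdr : ∀ r ∈ Ioo s t, ∀ θ, HasDerivAt (f · θ) (fr r θ) r)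
    (hdθ : ∀ r θ, HasDerivAt (f r) (fθ r θ) θ)
    (hper : ∀ r θ, f r (θ + 2 * Real.pi) = f r θ)
    (hper_r : ∀ r θ, fr r (θ + 2 * Real.pi) = fr r θ)
    (hper_θ : ∀ r θ, fθ r (θ + 2 * Real.pi) = fθ r θ)
    {P Q : ℝ → ℝ} (hPc : ContinuousOn P (Icc s t))
    (hP : ∀ r ∈ Ioo s t, HasDerivAt P ((1 - P r ^ 2) / r) r)
    (hQc : ContinuousOn Q (Icc s t))
    (hQ : ∀ r ∈ Ioo s t, HasDerivAt Q ((4 - Q r ^ 2) / r) r) :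
    weightedMass (P t) (Q t) (f t) - weightedMass (P s) (Q s) (f s) ≤
      ∫ r in s..t, (r * (∫ θ in 0..2 * Real.pi, fr r θ ^ 2) +
        (∫ θ in 0..2 * Real.pi, fθ r θ ^ 2) / r) := by
  have hpi := Real.pi_pos
  have sec : ∀ {F : ℝ → ℝ → ℝ}, Continuous ↿F → ∀ r, Continuous (F r) :=
    fun h r => h.comp (by fun_prop : Continuous fun θ => (r, θ))
  have shift : ∀ r θ, HasDerivAt (fun x => f r (x + Real.pi)) (fθ r (θ + Real.pi)) θ :=
    fun r θ => (hdθ r (θ + Real.pi)).comp_add_const θ Real.pi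
  have pp : ∀ r θ, f r (θ + Real.pi + Real.pi) = f r θ := fun r θ => by
    rw [← hper r θ]; congr 1; ring
  have O := riccati_energy_bound (continuous_oddPart hf) (continuous_oddPart hfr)
    (continuous_oddPart hfθ) hs hst (T := 2 * Real.pi) (by positivity)
    (fun r hr θ => ((hdr r hr θ).sub (hdr r hr (θ + Real.pi))).div_const 2)
    (fun r θ => ((hdθ r θ).sub (shift r θ)).div_const 2)
    (fun r => by
      have h1 := hper r 0
      have h2 := hper r Real.pi
      rw [zero_add] at h1
      simp only [oddPart, h1, zero_add, add_comm (2 * Real.pi), h2])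
    hPc (fun r hr => by simpa [hpi.ne'] using hP r hr)
  -- Taking the period `π` instead of `2π` raises the Wirtinger constant from 1 to 4.
  have E := riccati_energy_bound (continuous_evenPart hf) (continuous_evenPart hfr)
    (continuous_evenPart hfθ) hs hst hpi
    (fun r hr θ => ((hdr r hr θ).add (hdr r hr (θ + Real.pi))).div_const 2)
    (fun r θ => ((hdθ r θ).add (shift r θ)).div_const 2)
    (fun r => by
      have h1 := pp r 0
      rw [zero_add] at h1
      simp only [evenPart, h1, zero_add]
      ring)
    hQc (fun r hr => by
      convert hQ r hr using 2
      field_simp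
      norm_num)
  have sq : ∀ {F : ℝ → ℝ → ℝ}, Continuous ↿F → Continuous ↿(fun r θ => F r θ ^ 2) :=
    fun h => h.pow 2
  have int : ∀ {F G : ℝ → ℝ → ℝ} (T : ℝ), Continuous ↿F → Continuous ↿G → IntervalIntegrable
      (fun r => r * (∫ θ in 0..T, F r θ ^ 2) + (∫ θ in 0..T, G r θ ^ 2) / r) volume s t := by
    intro F G T hF hG
    refine ContinuousOn.intervalIntegrable_of_Icc hst ?_
    refine (continuous_id.mul (continuous_integral_of_continuous (sq hF) 0 T)).continuousOn.add ?_
    exact (continuous_integral_of_continuous (sq hG) 0 T).continuousOn.div continuousOn_id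
      fun r hr => (hs.trans_le hr.1).ne'
  calc _ = (P t * variation (2 * Real.pi) (oddPart (f t)) -
        P s * variation (2 * Real.pi) (oddPart (f s))) +
        2 * (Q t * variation Real.pi (evenPart (f t)) -
        Q s * variation Real.pi (evenPart (f s))) := by unfold weightedMass; ring
    _ ≤ _ := add_le_add O (mul_le_mul_of_nonneg_left E zero_le_two)
    _ = _ := by
      rw [← intervalIntegral.integral_const_mul, ← integral_add
        (int _ (continuous_oddPart hfr) (continuous_oddPart hfθ))
        ((int _ (continuous_evenPart hfr) (continuous_evenPart hfθ)).const_mul 2)]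
      refine integral_congr fun r _ => ?_
      rw [← integral_oddPart_sq_add_evenPart_sq (sec hfr r) (hper_r r),
        ← integral_oddPart_sq_add_evenPart_sq (sec hfθ r) (hper_θ r)]
      ring

/-- This is `r v' / v` for `v = r - δ²/r`, the radial factor of the harmonic function of frequency 1
vanishing at radius `δ`. -/
theorem hasDerivAt_riccati_one {δ r : ℝ} (hr : 0 < r) (h : r ^ 2 - δ ^ 2 ≠ 0) :
    HasDerivAt (fun r : ℝ => (r ^ 2 + δ ^ 2) / (r ^ 2 - δ ^ 2))
      ((1 - ((r ^ 2 + δ ^ 2) / (r ^ 2 - δ ^ 2)) ^ 2) / r) r := by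
  have d := hasDerivAt_pow 2 r
  refine ((d.add_const (δ ^ 2)).fun_div (d.sub_const (δ ^ 2)) h).congr_deriv ?_
  push_cast
  field_simp
  ring

/-- This is `r v' / v` for `v = r² + ε⁴/r²`, the radial factor of frequency 2 with a Neumann
condition at radius `ε`. -/
theorem hasDerivAt_riccati_two {ε r : ℝ} (hr : 0 < r) :
    HasDerivAt (fun r : ℝ => 2 * (r ^ 4 - ε ^ 4) / (r ^ 4 + ε ^ 4))
      ((4 - (2 * (r ^ 4 - ε ^ 4) / (r ^ 4 + ε ^ 4)) ^ 2) / r) r := by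
  have d := hasDerivAt_pow 4 r
  have h : r ^ 4 + ε ^ 4 ≠ 0 := by positivity
  refine (((d.sub_const (ε ^ 4)).const_mul 2).fun_div (d.add_const (ε ^ 4)) h).congr_deriv ?_
  push_cast
  field_simp
  ring

theorem continuous_weightedMass {F : ℝ → ℝ → ℝ} (hF : Continuous ↿F) {P Q : ℝ → ℝ} {s : Set ℝ}
    (hP : ContinuousOn P s) (hQ : ContinuousOn Q s) :
    ContinuousOn (fun r => weightedMass (P r) (Q r) (F r)) s :=
  (hP.mul (continuous_variation (continuous_oddPart hF) _).continuousOn).add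
    (hQ.mul ((continuous_variation (continuous_evenPart hF) _).const_mul 2).continuousOn)

/-- On mean-zero functions the weighted mass dominates the `L²` norm. -/
theorem le_weightedMass {a b : ℝ} (hab : a ≤ b) {g : ℝ → ℝ} (hg : Continuous g)
    (hper : ∀ θ, g (θ + 2 * Real.pi) = g θ) (hmean : ∫ θ in 0..2 * Real.pi, g θ = 0) :
    a * ∫ θ in 0..2 * Real.pi, g θ ^ 2 ≤ weightedMass a b g := by
  rw [← integral_oddPart_sq_add_evenPart_sq hg hper, weightedMass, variation, variation,
    integral_oddPart hg hper, integral_evenPart hg, hmean]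
  have : 0 ≤ ∫ θ in 0..Real.pi, evenPart g θ ^ 2 :=
    intervalIntegral.integral_nonneg Real.pi_pos.le fun θ _ => sq_nonneg _
  have := mul_le_mul_of_nonneg_right hab this
  simp only [zero_pow two_ne_zero, zero_div, sub_zero]
  linarith

theorem weightedMass_zero_of_even (a : ℝ) {g : ℝ → ℝ} (h : ∀ θ, g (θ + Real.pi) = g θ) :
    weightedMass a 0 g = 0 := by
  have : oddPart g = 0 := by
    funext θ
    simp [oddPart, h]
  simp [weightedMass, variation, this]

/-! ### Polar coordinates on the annulus -/

/-- The open annulus. -/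
def openAnnulus (ε : ℝ) : Set ℂ := {z | ε < ‖z‖ ∧ ‖z‖ < 1}

theorem isOpen_openAnnulus (ε : ℝ) : IsOpen (openAnnulus ε) :=
  (isOpen_lt continuous_const continuous_norm).inter (isOpen_lt continuous_norm continuous_const)

theorem openAnnulus_subset (ε : ℝ) : openAnnulus ε ⊆ annulus ε := fun _ hz => ⟨hz.1.le, hz.2.le⟩

theorem circleMap_mem_openAnnulus {ε r : ℝ} (hε : 0 < ε) (h : ε < r) (h1 : r < 1) (θ : ℝ) :
    circleMap 0 r θ ∈ openAnnulus ε := by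
  simp [openAnnulus, abs_of_pos (hε.trans h), h, h1]

theorem circleMap_mem_annulus {ε r : ℝ} (hε : 0 < ε) (h : ε ≤ r) (h1 : r ≤ 1) (θ : ℝ) :
    circleMap 0 r θ ∈ annulus ε := by
  simp [annulus, abs_of_pos (hε.trans_le h), h, h1]

theorem circleMap_add_pi (r θ : ℝ) : circleMap 0 r (θ + Real.pi) = -circleMap 0 r θ := by
  simp [circleMap, add_mul, Complex.exp_add, Complex.exp_pi_mul_I]

/-- The retraction of the line on `[s, t]`. -/
def clamp (s t r : ℝ) : ℝ := max s (min t r)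

theorem continuous_clamp (s t : ℝ) : Continuous (clamp s t) := by
  unfold clamp
  fun_prop

theorem clamp_mem {s t : ℝ} (h : s ≤ t) (r : ℝ) : clamp s t r ∈ Icc s t :=
  ⟨le_max_left _ _, max_le h (min_le_left _ _)⟩

theorem clamp_eq {s t r : ℝ} (h : r ∈ Icc s t) : clamp s t r = r := by
  simp [clamp, h.1, h.2]

theorem continuous_polar (s t : ℝ) :
    Continuous fun p : ℝ × ℝ => circleMap 0 (clamp s t p.1) p.2 := by
  have := (continuous_clamp s t).comp (continuous_fst (X := ℝ) (Y := ℝ))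
  simp only [circleMap]
  fun_prop

/-- A function on the plane in polar coordinates, with the radius clamped to `[s, t]`. -/
def polar (s t : ℝ) (u : ℂ → ℝ) (r θ : ℝ) : ℝ := u (circleMap 0 (clamp s t r) θ)

/-- The radial derivative in clamped polar coordinates. -/
def polarRadial (s t : ℝ) (u : ℂ → ℝ) (r θ : ℝ) : ℝ :=
  fderiv ℝ u (circleMap 0 (clamp s t r) θ) (circleMap 0 1 θ)

/-- The angular derivative in clamped polar coordinates. -/
def polarAngular (s t : ℝ) (u : ℂ → ℝ) (r θ : ℝ) : ℝ :=
  fderiv ℝ u (circleMap 0 (clamp s t r) θ) (circleMap 0 (clamp s t r) θ * Complex.I)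

theorem continuous_polar_of_continuousOn {ε s t : ℝ} (hε : 0 < ε) (hs : ε ≤ s) (hst : s ≤ t)
    (ht : t ≤ 1) {u : ℂ → ℝ} (hu : ContinuousOn u (annulus ε)) : Continuous ↿(polar s t u) :=
  hu.comp_continuous (continuous_polar s t) fun p =>
    have h := clamp_mem hst p.1
    circleMap_mem_annulus hε (hs.trans h.1) (h.2.trans ht) p.2

section

variable {ε s t : ℝ} {u : ℂ → ℝ}

theorem continuousOn_fderiv (hu : ContDiffOn ℝ ∞ u (annulus ε)) :
    ContinuousOn (fderiv ℝ u) (openAnnulus ε) :=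
  (hu.mono (openAnnulus_subset ε)).continuousOn_fderiv_of_isOpen (isOpen_openAnnulus ε)
    (by norm_cast)

theorem hasFDerivAt_of_mem (hu : ContDiffOn ℝ ∞ u (annulus ε)) {z : ℂ} (hz : z ∈ openAnnulus ε) :
    HasFDerivAt u (fderiv ℝ u z) z :=
  (((hu.mono (openAnnulus_subset ε)).contDiffAt ((isOpen_openAnnulus ε).mem_nhds hz)).differentiableAt
    (by norm_num)).hasFDerivAt

/-- Smoothness on the closed annulus controls `fderiv` only at interior points, hence the strict
bounds on the radii. -/
theorem continuous_fderiv_polar (hε : 0 < ε) (hs : ε < s) (hst : s ≤ t) (ht : t < 1)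
    (hu : ContDiffOn ℝ ∞ u (annulus ε)) :
    Continuous fun p : ℝ × ℝ => fderiv ℝ u (circleMap 0 (clamp s t p.1) p.2) :=
  (continuousOn_fderiv hu).comp_continuous (continuous_polar s t) fun p =>
    have h := clamp_mem hst p.1
    circleMap_mem_openAnnulus hε (hs.trans_le h.1) (h.2.trans_lt ht) p.2

theorem continuous_polarRadial (hε : 0 < ε) (hs : ε < s) (hst : s ≤ t) (ht : t < 1)
    (hu : ContDiffOn ℝ ∞ u (annulus ε)) : Continuous ↿(polarRadial s t u) :=
  (continuous_fderiv_polar hε hs hst ht hu).clm_apply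
    ((continuous_circleMap 0 1).comp continuous_snd)

theorem continuous_polarAngular (hε : 0 < ε) (hs : ε < s) (hst : s ≤ t) (ht : t < 1)
    (hu : ContDiffOn ℝ ∞ u (annulus ε)) : Continuous ↿(polarAngular s t u) :=
  (continuous_fderiv_polar hε hs hst ht hu).clm_apply
    ((continuous_polar s t).mul continuous_const)

theorem hasDerivAt_radius (r θ : ℝ) :
    HasDerivAt (fun r : ℝ => circleMap 0 r θ) (circleMap 0 1 θ) r := by
  have := ((hasDerivAt_id r).ofReal_comp).mul_const (Complex.exp (θ * Complex.I))
  simpa [circleMap] using this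

theorem hasDerivAt_along_radius (hε : 0 < ε) (hu : ContDiffOn ℝ ∞ u (annulus ε)) {r : ℝ}
    (hr : ε < r) (hr1 : r < 1) (θ : ℝ) :
    HasDerivAt (fun r : ℝ => u (circleMap 0 r θ))
      (fderiv ℝ u (circleMap 0 r θ) (circleMap 0 1 θ)) r :=
  (hasFDerivAt_of_mem hu (circleMap_mem_openAnnulus hε hr hr1 θ)).comp_hasDerivAt r
    (hasDerivAt_radius r θ)

theorem hasDerivAt_polar_radius (hε : 0 < ε) (hs : ε < s) (ht : t < 1)
    (hu : ContDiffOn ℝ ∞ u (annulus ε)) {r : ℝ} (hr : r ∈ Ioo s t) (θ : ℝ) :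
    HasDerivAt (polar s t u · θ) (polarRadial s t u r θ) r := by
  have h := hasDerivAt_along_radius hε hu (hs.trans hr.1) (hr.2.trans ht) θ
  rw [polarRadial, clamp_eq (Ioo_subset_Icc_self hr)]
  refine h.congr_of_eventuallyEq ?_
  filter_upwards [Ioo_mem_nhds hr.1 hr.2] with x hx
  rw [polar, clamp_eq (Ioo_subset_Icc_self hx)]

theorem hasDerivAt_polar_angle (hε : 0 < ε) (hs : ε < s) (hst : s ≤ t) (ht : t < 1)
    (hu : ContDiffOn ℝ ∞ u (annulus ε)) (r θ : ℝ) :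
    HasDerivAt (polar s t u r) (polarAngular s t u r θ) θ :=
  have h := clamp_mem hst r
  (hasFDerivAt_of_mem hu (circleMap_mem_openAnnulus hε (hs.trans_le h.1)
    (h.2.trans_lt ht) θ)).comp_hasDerivAt θ (hasDerivAt_circleMap 0 _ θ)

/-- The unit radial vector and its rotation by `Complex.I` form an orthonormal basis. -/
theorem norm_gradient_sq (u : ℂ → ℝ) (z : ℂ) (θ : ℝ) :
    ‖gradient u z‖ ^ 2 = fderiv ℝ u z (circleMap 0 1 θ) ^ 2 +
      fderiv ℝ u z (circleMap 0 1 θ * Complex.I) ^ 2 := by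
  have e : circleMap 0 1 θ = ⟨Real.cos θ, Real.sin θ⟩ := by
    simp [circleMap, Complex.exp_mul_I, ← Complex.ofReal_cos, ← Complex.ofReal_sin,
      Complex.ext_iff]
  rw [← toDual_gradient, InnerProductSpace.toDual_apply_apply, InnerProductSpace.toDual_apply_apply,
    Complex.inner, Complex.inner, ← Complex.normSq_eq_norm_sq, Complex.normSq_apply, e]
  simp only [Complex.mul_re, Complex.mul_im, Complex.conj_re, Complex.conj_im, Complex.I_re,
    Complex.I_im]
  linear_combination (-(gradient u z).re ^ 2 - (gradient u z).im ^ 2) * Real.sin_sq_add_cos_sq θ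

theorem polarAngular_eq (r θ : ℝ) : polarAngular s t u r θ =
    clamp s t r * fderiv ℝ u (circleMap 0 (clamp s t r) θ) (circleMap 0 1 θ * Complex.I) := by
  have : circleMap 0 (clamp s t r) θ * Complex.I =
      clamp s t r • (circleMap 0 1 θ * Complex.I) := by
    simp [circleMap, mul_assoc]
  rw [polarAngular, this, map_smul, smul_eq_mul]

theorem periodic_polar (r θ : ℝ) : polar s t u r (θ + 2 * Real.pi) = polar s t u r θ := by
  rw [polar, periodic_circleMap, polar]

theorem periodic_polarRadial (r θ : ℝ) :
    polarRadial s t u r (θ + 2 * Real.pi) = polarRadial s t u r θ := by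
  rw [polarRadial, periodic_circleMap, periodic_circleMap, polarRadial]

theorem periodic_polarAngular (r θ : ℝ) :
    polarAngular s t u r (θ + 2 * Real.pi) = polarAngular s t u r θ := by
  rw [polarAngular, periodic_circleMap, polarAngular]

/-- The Dirichlet energy of a smaller annulus in polar coordinates. -/
theorem polar_energy_le (hε : 0 < ε) (hs : ε < s) (hst : s ≤ t) (ht : t < 1)
    (hu : ContDiffOn ℝ ∞ u (annulus ε)) :
    ENNReal.ofReal (∫ r in s..t, (r * (∫ θ in 0..2 * Real.pi, polarRadial s t u r θ ^ 2) +
      (∫ θ in 0..2 * Real.pi, polarAngular s t u r θ ^ 2) / r)) ≤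
      ∫⁻ z in openAnnulus ε, ENNReal.ofReal (‖gradient u z‖ ^ 2) := by
  have s0 : 0 < s := hε.trans hs
  set G : ℝ × ℝ → ℝ := fun p => p.1 * ‖gradient u (circleMap 0 (clamp s t p.1) p.2)‖ ^ 2 with hG
  have sec : ∀ {F : ℝ → ℝ → ℝ}, Continuous ↿F → ∀ r, Continuous (F r) :=
    fun h r => h.comp (by fun_prop : Continuous fun θ => (r, θ))
  have cr := continuous_polarRadial hε hs hst ht hu
  have cθ := continuous_polarAngular hε hs hst ht hu
  have cG : Continuous G := by
    have h1 : ∀ p : ℝ × ℝ, ‖gradient u (circleMap 0 (clamp s t p.1) p.2)‖ =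
        ‖fderiv ℝ u (circleMap 0 (clamp s t p.1) p.2)‖ := fun p => by
      rw [← toDual_gradient, LinearIsometryEquiv.norm_map]
    simp only [hG, h1]
    exact continuous_fst.mul ((continuous_fderiv_polar hε hs hst ht hu).norm.pow 2)
  have iG : IntegrableOn G (Ioc s t ×ˢ Ioo (-Real.pi) Real.pi) :=
    (cG.continuousOn.integrableOn_compact (isCompact_Icc.prod isCompact_Icc)).mono_set
      (prod_mono Ioc_subset_Icc_self Ioo_subset_Icc_self)
  have pointwise : ∀ r ∈ Icc s t, (∫ θ in Ioo (-Real.pi) Real.pi, G (r, θ)) =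
      r * (∫ θ in 0..2 * Real.pi, polarRadial s t u r θ ^ 2) +
      (∫ θ in 0..2 * Real.pi, polarAngular s t u r θ ^ 2) / r := by
    intro r hr
    have r0 : r ≠ 0 := (s0.trans_le hr.1).ne'
    rw [← integral_Ioc_eq_integral_Ioo, ← intervalIntegral.integral_of_le (by linarith [Real.pi_pos])]
    -- `Complex.polarCoord` takes angles in `(-π, π)`; periodicity moves the integral to `[0, 2π]`.
    have hper : Function.Periodic (fun θ => G (r, θ)) (2 * Real.pi) := fun θ => by
      simp only [hG]
      rw [periodic_circleMap]
    have := hper.intervalIntegral_add_eq (-Real.pi) 0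
    rw [show -Real.pi + 2 * Real.pi = Real.pi by ring, zero_add] at this
    rw [this, ← intervalIntegral.integral_const_mul, ← intervalIntegral.integral_div,
      ← intervalIntegral.integral_add]
    · refine integral_congr fun θ _ => ?_
      simp only [hG]
      rw [norm_gradient_sq u _ θ, polarAngular_eq, polarRadial, clamp_eq hr]
      field_simp
    · exact (((sec cr r).pow 2).const_mul r).intervalIntegrable _ _
    · exact (((sec cθ r).pow 2).div_const r).intervalIntegrable _ _
  have e1 : (∫ r in s..t, (r * (∫ θ in 0..2 * Real.pi, polarRadial s t u r θ ^ 2) +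
      (∫ θ in 0..2 * Real.pi, polarAngular s t u r θ ^ 2) / r)) =
      ∫ p in Ioc s t ×ˢ Ioo (-Real.pi) Real.pi, G p := by
    rw [Measure.volume_eq_prod, setIntegral_prod _ iG, intervalIntegral.integral_of_le hst]
    exact setIntegral_congr_fun measurableSet_Ioc fun r hr =>
      (pointwise r (Ioc_subset_Icc_self hr)).symm
  have mS : MeasurableSet (Ioc s t ×ˢ Ioo (-Real.pi) Real.pi) :=
    measurableSet_Ioc.prod measurableSet_Ioo
  rw [e1, ofReal_integral_eq_lintegral_ofReal iG ((ae_restrict_mem mS).mono fun p hp =>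
    mul_nonneg (s0.le.trans hp.1.1.le) (sq_nonneg _)),
    ← lintegral_indicator (isOpen_openAnnulus ε).measurableSet,
    ← Complex.lintegral_comp_polarCoord_symm]
  refine le_trans (le_of_eq ?_) (lintegral_mono_set (s := Ioc s t ×ˢ Ioo (-Real.pi) Real.pi)
    (prod_mono (fun r hr => s0.trans hr.1) subset_rfl))
  refine setLIntegral_congr_fun mS fun p hp => ?_
  have hr : p.1 ∈ Icc s t := Ioc_subset_Icc_self hp.1
  have e2 : Complex.polarCoord.symm p = circleMap 0 p.1 p.2 := by
    rw [Complex.polarCoord_symm_apply, circleMap_zero, Complex.exp_mul_I]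
    push_cast
    rfl
  simp only [hG, e2]
  rw [indicator_of_mem (circleMap_mem_openAnnulus hε (hs.trans_le hr.1) (hr.2.trans_lt ht) _),
    clamp_eq hr, ENNReal.ofReal_mul (s0.le.trans hr.1), smul_eq_mul]

/-! ### The Steklov inequality on the annulus -/

/-- A lower bound, larger than `1`, of the first Steklov eigenvalue. -/
def steklovBound (ε : ℝ) : ℝ := (1 + (ε / 2) ^ 2) / (1 - (ε / 2) ^ 2)

theorem one_lt_steklovBound (hε : 0 < ε) (hε1 : ε < 1 / 2) : 1 < steklovBound ε := by
  have : 0 < (ε / 2) ^ 2 := by positivity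
  rw [steklovBound, one_lt_div (by nlinarith)]
  linarith

/-- The odd modes are the weaker ones: at `ε = 1/2` the two sides are `17/15` and `30/17`, and they
move apart as `ε` decreases. -/
theorem steklovBound_le (hε : 0 < ε) (hε1 : ε < 1 / 2) :
    steklovBound ε ≤ 2 * (1 ^ 4 - ε ^ 4) / (1 ^ 4 + ε ^ 4) := by
  have h2 : ε ^ 2 < 1 / 4 := by nlinarith
  have h2' : 0 < ε ^ 2 := by positivity
  have h4 : ε ^ 4 < 1 / 16 := by
    calc ε ^ 4 = ε ^ 2 * ε ^ 2 := by ring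
      _ < 1 / 16 := by nlinarith
  rw [steklovBound, div_le_div_iff₀ (by nlinarith) (by positivity)]
  have : 0 < ε ^ 4 := by positivity
  nlinarith

/-- The Steklov inequality on the annulus for mean-zero functions that are even on the inner
circle. -/
theorem steklovBound_mul_le (hε : 0 < ε) (hε1 : ε < 1 / 2) (hu : ContDiffOn ℝ ∞ u (annulus ε))
    (heven : ∀ z : ℂ, ‖z‖ = ε → u (-z) = u z)
    (hmean : ∫ θ in 0..2 * Real.pi, u (circleMap 0 1 θ) = 0) :
    ENNReal.ofReal (steklovBound ε * ∫ θ in 0..2 * Real.pi, u (circleMap 0 1 θ) ^ 2) ≤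
      ∫⁻ z in openAnnulus ε, ENNReal.ofReal (‖gradient u z‖ ^ 2) := by
  set E := ∫⁻ z in openAnnulus ε, ENNReal.ofReal (‖gradient u z‖ ^ 2) with hE
  rcases eq_or_ne E ⊤ with hT | hT
  · rw [hT]; exact le_top
  rw [ENNReal.ofReal_le_iff_le_toReal hT]
  have hεle : ε ≤ 1 := by linarith
  -- The sharp choice `δ = ε` would put the pole on the inner circle. Taking `δ = ε / 2` keeps `P`
  -- continuous on `[ε, 1]` and still gives `P 1 > 1`.
  set P : ℝ → ℝ := fun r => (r ^ 2 + (ε / 2) ^ 2) / (r ^ 2 - (ε / 2) ^ 2) with hP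
  set Q : ℝ → ℝ := fun r => 2 * (r ^ 4 - ε ^ 4) / (r ^ 4 + ε ^ 4) with hQ
  have hden : ∀ r, ε ≤ r → r ^ 2 - (ε / 2) ^ 2 ≠ 0 := fun r hr => by nlinarith
  have dP : ∀ r, ε ≤ r → HasDerivAt P ((1 - P r ^ 2) / r) r := fun r hr =>
    hasDerivAt_riccati_one (hε.trans_le hr) (hden r hr)
  have dQ : ∀ r, ε ≤ r → HasDerivAt Q ((4 - Q r ^ 2) / r) r := fun r hr =>
    hasDerivAt_riccati_two (hε.trans_le hr)
  have cP : ContinuousOn P (Icc ε 1) := fun r hr => (dP r hr.1).continuousAt.continuousWithinAt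
  have cQ : ContinuousOn Q (Icc ε 1) := fun r hr => (dQ r hr.1).continuousAt.continuousWithinAt
  have cF := continuous_polar_of_continuousOn hε le_rfl hεle le_rfl hu.continuousOn
  set G : ℝ → ℝ := fun r => weightedMass (P r) (Q r) (polar ε 1 u r) with hG
  have cG : ContinuousOn G (Icc ε 1) := continuous_weightedMass cF cP cQ
  have agree : ∀ {s t r : ℝ}, ε < s → t < 1 → r ∈ Icc s t → polar s t u r = polar ε 1 u r := by
    intro s t r hs ht hr
    funext θ
    rw [polar, polar, clamp_eq hr, clamp_eq ⟨hs.le.trans hr.1, hr.2.trans ht.le⟩]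
  have step : ∀ s t, ε < s → s ≤ t → t < 1 → G t - G s ≤ E.toReal := by
    intro s t hs hst ht
    refine le_trans ?_ ((ENNReal.ofReal_le_iff_le_toReal hT).1 (polar_energy_le hε hs hst ht hu))
    have sub : Icc s t ⊆ Icc ε 1 := Icc_subset_Icc hs.le ht.le
    have := weightedMass_sub_le
      (continuous_polar_of_continuousOn hε hs.le hst ht.le hu.continuousOn)
      (continuous_polarRadial hε hs hst ht hu) (continuous_polarAngular hε hs hst ht hu)
      (hε.trans hs) hst (fun r hr θ => hasDerivAt_polar_radius hε hs ht hu hr θ)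
      (hasDerivAt_polar_angle hε hs hst ht hu) periodic_polar periodic_polarRadial
      periodic_polarAngular (cP.mono sub) (fun r hr => dP r (hs.le.trans hr.1.le))
      (cQ.mono sub) (fun r hr => dQ r (hs.le.trans hr.1.le))
    rwa [agree hs ht ⟨hst, le_rfl⟩, agree hs ht ⟨le_rfl, hst⟩] at this
  -- The energy bound is known on interior annuli only; `G` is continuous up to both boundary
  -- circles, so both radii pass to the limit.
  have lim : G 1 - G ε ≤ E.toReal := by
    have t1 : Tendsto (fun η : ℝ => 1 - η) (𝓝[Ioo 0 ((1 - ε) / 2)] 0) (𝓝[Icc ε 1] 1) := by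
      refine tendsto_nhdsWithin_iff.2 ⟨?_, ?_⟩
      · exact ((by fun_prop : Continuous fun η : ℝ => 1 - η).tendsto' 0 1 (by simp)).mono_left
          nhdsWithin_le_nhds
      · filter_upwards [self_mem_nhdsWithin] with η hη
        constructor <;> linarith [hη.1, hη.2]
    have t2 : Tendsto (fun η : ℝ => ε + η) (𝓝[Ioo 0 ((1 - ε) / 2)] 0) (𝓝[Icc ε 1] ε) := by
      refine tendsto_nhdsWithin_iff.2 ⟨?_, ?_⟩
      · exact ((by fun_prop : Continuous fun η : ℝ => ε + η).tendsto' 0 ε (by simp)).mono_left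
          nhdsWithin_le_nhds
      · filter_upwards [self_mem_nhdsWithin] with η hη
        constructor <;> linarith [hη.1, hη.2]
    have := ((cG 1 ⟨hεle, le_rfl⟩).tendsto.comp t1).sub ((cG ε ⟨le_rfl, hεle⟩).tendsto.comp t2)
    have : (𝓝[Ioo (0 : ℝ) ((1 - ε) / 2)] 0).NeBot := by
      rw [nhdsWithin_Ioo_eq_nhdsGT (by linarith)]
      infer_instance
    refine le_of_tendsto ‹Tendsto _ _ _› ?_
    filter_upwards [self_mem_nhdsWithin] with η hη
    exact step _ _ (by linarith [hη.1]) (by linarith [hη.2]) (by linarith [hη.1])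
  -- `Q` vanishes at `ε`, which removes the even part, and the gluing condition removes the odd
  -- part.
  have G0 : G ε = 0 := by
    have : Q ε = 0 := by simp [hQ]
    simp only [hG, this]
    refine weightedMass_zero_of_even _ fun θ => ?_
    rw [polar, polar, circleMap_add_pi, heven]
    simp [clamp_eq (left_mem_Icc.2 hεle), abs_of_pos hε]
  have e : polar ε 1 u 1 = fun θ => u (circleMap 0 1 θ) := by
    funext θ
    rw [polar, clamp_eq (right_mem_Icc.2 hεle)]
  have c1 : Continuous (polar ε 1 u 1) := cF.comp (by fun_prop : Continuous fun θ : ℝ => ((1 : ℝ), θ))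
  have G1 := le_weightedMass (a := P 1) (b := Q 1)
    (by simpa [hP, hQ, steklovBound] using steklovBound_le hε hε1) c1 (periodic_polar 1)
    (by rw [e]; exact hmean)
  rw [G0, sub_zero] at lim
  have P1 : P 1 = steklovBound ε := by simp [hP, steklovBound]
  rw [P1, e] at G1
  refine G1.trans (le_trans (le_of_eq ?_) lim)
  simp only [hG, P1, e]

/-- A function without Dirichlet energy that vanishes on the outer circle vanishes. -/
theorem eq_zero_of_energy_eq_zero (hε : 0 < ε) (hu : ContDiffOn ℝ ∞ u (annulus ε))
    (hE : ∫⁻ z in openAnnulus ε, ENNReal.ofReal (‖gradient u z‖ ^ 2) = 0)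
    (hB : ∫⁻ θ in Ioc 0 (2 * Real.pi), ENNReal.ofReal (u (circleMap 0 1 θ) ^ 2) = 0)
    (hε1 : ε ≤ 1) : ∀ z ∈ annulus ε, u z = 0 := by
  have outer : ∀ θ ∈ Ioc 0 (2 * Real.pi), u (circleMap 0 1 θ) = 0 := by
    have c : Continuous fun θ => u (circleMap 0 1 θ) :=
      hu.continuousOn.comp_continuous (continuous_circleMap 0 1)
        (circleMap_mem_annulus hε hε1 le_rfl)
    rw [lintegral_eq_zero_iff (c.fun_pow 2).measurable.ennreal_ofReal] at hB
    refine Measure.eqOn_Ioc_of_ae_eq (μ := volume) (g := fun _ => 0) ?_ c.continuousOn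
      continuousOn_const
    filter_upwards [hB] with θ hθ
    simpa using hθ
  have inner : ∀ z ∈ openAnnulus ε, fderiv ℝ u z = 0 := by
    have n : ∀ z, ‖gradient u z‖ = ‖fderiv ℝ u z‖ := fun z => by
      rw [← toDual_gradient, LinearIsometryEquiv.norm_map]
    simp only [n] at hE
    have c := continuousOn_fderiv hu
    have m : AEMeasurable (fun z => ENNReal.ofReal (‖fderiv ℝ u z‖ ^ 2))
        (volume.restrict (openAnnulus ε)) :=
      ENNReal.measurable_ofReal.comp_aemeasurable
        ((c.norm.pow 2).aemeasurable (isOpen_openAnnulus ε).measurableSet)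
    rw [lintegral_eq_zero_iff' m] at hE
    refine Measure.eqOn_open_of_ae_eq (μ := volume) (g := fun _ => 0) ?_ (isOpen_openAnnulus ε) c
      continuousOn_const
    filter_upwards [hE] with z hz
    have h : ‖fderiv ℝ u z‖ ^ 2 ≤ 0 := ENNReal.ofReal_eq_zero.1 hz
    exact norm_eq_zero.1 (pow_eq_zero_iff two_ne_zero |>.1 (le_antisymm h (sq_nonneg _)))
  intro z hz
  obtain ⟨θ, hθm, hθz⟩ : ∃ θ ∈ Ioc 0 (2 * Real.pi), circleMap 0 ‖z‖ θ = z := by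
    have : z ∈ circleMap 0 ‖z‖ '' Ioc 0 (2 * Real.pi) := by
      rw [image_circleMap_Ioc]; simp
    exact this
  rcases eq_or_lt_of_le hz.2 with h1 | h1
  · rw [← hθz, h1]; exact outer θ hθm
  -- The mean value theorem along the ray from `z` to the outer circle, where `u` vanishes.
  · obtain ⟨r, hr, h⟩ := exists_hasDerivAt_eq_slope (fun r => u (circleMap 0 r θ))
      (fun r => fderiv ℝ u (circleMap 0 r θ) (circleMap 0 1 θ)) h1
      (hu.continuousOn.comp (by unfold circleMap; fun_prop) fun r hr =>
        circleMap_mem_annulus hε (hz.1.trans hr.1) hr.2 θ)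
      (fun r hr => hasDerivAt_along_radius hε hu (hz.1.trans_lt hr.1) hr.2 θ)
    simp only [inner _ (circleMap_mem_openAnnulus hε (hz.1.trans_lt hr.1) hr.2 θ), hθz,
      outer θ hθm] at h
    have : (1 - ‖z‖) ≠ 0 := by linarith
    field_simp at h
    simpa using h

end

/-! ### From the annulus to the Möbius band: the lower bound -/

variable {ε : ℝ}

theorem sheet_true (z : annulus ε) : sheet true z = sheet false (antipode z) :=
  Quotient.sound (Or.inr rfl)

theorem sheet_eq_of_norm_eq (z : annulus ε) (hz : ‖(z : ℂ)‖ = ε) :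
    sheet true z = sheet false z :=
  congrArg (Quotient.mk (mobiusSetoid ε)) (Quotient.sound ⟨rfl, Or.inr hz⟩)

theorem exists_sheet_false (p : MobiusBand ε) : ∃ z : annulus ε, sheet false z = p := by
  induction p using Quotient.inductionOn with
  | h p =>
    induction p using Quotient.inductionOn with
    | h p =>
      obtain ⟨i, z⟩ := p
      cases i
      · exact ⟨z, rfl⟩
      · exact ⟨antipode z, (sheet_true z).symm⟩

theorem pullback_apply (i : Bool) (φ : MobiusBand ε → ℝ) {z : ℂ} (hz : z ∈ annulus ε) :
    pullback i φ z = φ (sheet i ⟨z, hz⟩) := dif_pos hz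

/-- On the inner circle the gluing identifies the two copies of `z`, and the involution carries the
second copy to `-z` on the first. -/
theorem pullback_neg (φ : MobiusBand ε → ℝ) (hε : ε ≤ 1) {z : ℂ} (hz : ‖z‖ = ε) :
    pullback false φ (-z) = pullback false φ z := by
  have h : z ∈ annulus ε := ⟨hz.ge, hz.trans_le hε⟩
  have h' : -z ∈ annulus ε := by simpa [annulus] using h
  rw [pullback_apply _ _ h, pullback_apply _ _ h', ← sheet_eq_of_norm_eq ⟨z, h⟩ hz, sheet_true]
  rfl

theorem pullback_sq (φ : MobiusBand ε → ℝ) (z : ℂ) :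
    pullback false (fun p => φ p ^ 2) z = pullback false φ z ^ 2 := by
  by_cases h : z ∈ annulus ε <;> simp [pullback, h]

theorem continuous_boundary {φ : MobiusBand ε → ℝ} (hφ : φ ∈ testFunctions ε) (hε : 0 < ε)
    (hε1 : ε ≤ 1) : Continuous fun θ => pullback false φ (circleMap 0 1 θ) :=
  (hφ.2 false).continuousOn.comp_continuous (continuous_circleMap 0 1)
    (circleMap_mem_annulus hε hε1 le_rfl)

theorem boundaryIntegral_sq {φ : MobiusBand ε → ℝ} (hφ : φ ∈ testFunctions ε) (hε : 0 < ε)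
    (hε1 : ε ≤ 1) : boundaryIntegral (fun p => φ p ^ 2) =
      ENNReal.ofReal (∫ θ in 0..2 * Real.pi, pullback false φ (circleMap 0 1 θ) ^ 2) := by
  have c := (continuous_boundary hφ hε hε1).fun_pow 2
  rw [intervalIntegral.integral_of_le Real.two_pi_pos.le, ofReal_integral_eq_lintegral_ofReal
    c.integrableOn_Ioc (.of_forall fun _ => sq_nonneg _)]
  simp only [boundaryIntegral, pullback_sq]

theorem boundaryLength_eq (hε : 0 < ε) (hε1 : ε ≤ 1) :
    boundaryLength ε = ENNReal.ofReal (2 * Real.pi) := by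
  have (θ : ℝ) : pullback false (fun _ : MobiusBand ε => (1 : ℝ)) (circleMap 0 1 θ) = 1 :=
    pullback_apply _ _ (circleMap_mem_annulus hε hε1 le_rfl θ)
  simp [boundaryLength, boundaryIntegral, this]

/-- A two-dimensional space of test functions contains a non-zero function of mean zero on the
boundary. -/
theorem exists_mean_zero (hε : 0 < ε) (hε1 : ε ≤ 1) {V : Submodule ℝ (MobiusBand ε → ℝ)}
    (hV : V ≤ testFunctions ε) (hdim : Module.finrank ℝ V = 2) :
    ∃ φ ∈ V, φ ≠ 0 ∧ ∫ θ in 0..2 * Real.pi, pullback false φ (circleMap 0 1 θ) = 0 := by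
  let L : V →ₗ[ℝ] ℝ :=
    { toFun := fun φ => ∫ θ in 0..2 * Real.pi, pullback false φ.1 (circleMap 0 1 θ)
      map_add' := fun φ ψ => by
        simp only [Submodule.coe_add, pullback_add, Pi.add_apply]
        exact intervalIntegral.integral_add
          ((continuous_boundary (hV φ.2) hε hε1).intervalIntegrable _ _)
          ((continuous_boundary (hV ψ.2) hε hε1).intervalIntegrable _ _)
      map_smul' := fun c φ => by
        simp only [Submodule.coe_smul, pullback_smul, Pi.smul_apply, smul_eq_mul,
          RingHom.id_apply]
        exact intervalIntegral.integral_const_mul _ _ }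
  have : FiniteDimensional ℝ V := Module.finite_of_finrank_pos (by omega)
  have hker : LinearMap.ker L ≠ ⊥ := L.ker_ne_bot_of_finrank_lt (by simp [hdim])
  obtain ⟨φ, hφ, h0⟩ := Submodule.exists_mem_ne_zero_of_ne_bot hker
  exact ⟨φ.1, φ.2, fun h => h0 (Subtype.ext h), hφ⟩

theorem steklovBound_le_steklovEigenvalue (hε : 0 < ε) (hε1 : ε < 1 / 2) :
    ENNReal.ofReal (steklovBound ε) ≤ steklovEigenvalue ε 1 := by
  have h1 : ε ≤ 1 := by linarith
  refine le_iInf fun V => le_iInf fun hV => le_iInf fun hdim => ?_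
  obtain ⟨φ, hφV, hφ0, hmean⟩ := exists_mean_zero hε h1 hV hdim
  have hφ := hV hφV
  refine le_iSup_of_le φ (le_iSup_of_le hφV (le_iSup_of_le hφ0 ?_))
  have key := steklovBound_mul_le hε hε1 (hφ.2 false) (fun z hz => pullback_neg φ h1 hz) hmean
  have c0 : 0 ≤ steklovBound ε := (zero_lt_one.trans (one_lt_steklovBound hε hε1)).le
  rw [ENNReal.ofReal_mul c0, ← boundaryIntegral_sq hφ hε h1] at key
  rw [ENNReal.le_div_iff_mul_le]
  · exact key
  -- In `ℝ≥0∞` the quotient `0 / 0` is `0`, which would break the bound; it can only occur for `φ =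
  -- 0`.
  · by_contra! h
    apply hφ0
    funext p
    obtain ⟨z, rfl⟩ := exists_sheet_false p
    have hB := h.1
    simp only [boundaryIntegral, pullback_sq] at hB
    have := eq_zero_of_energy_eq_zero hε (hφ.2 false) h.2 hB h1 z z.2
    rwa [pullback_apply _ _ z.2] at this
  · rw [boundaryIntegral_sq hφ hε h1]
    exact Or.inl ENNReal.ofReal_ne_top

/-! ### Finiteness of the eigenvalue -/

/-- The function `Re z²` on the Möbius band. -/
def quadrupole (ε : ℝ) : MobiusBand ε → ℝ :=
  Quotient.lift (Quotient.lift (fun p : TwoSheets ε => ((p.2 : ℂ) ^ 2).re) (by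
    rintro p q ⟨h, -⟩
    simp only [h])) (by
    intro p q
    induction p using Quotient.inductionOn with
    | h p =>
      rintro (rfl | rfl)
      · rfl
      · change _ = ((-(p.2 : ℂ)) ^ 2).re
        rw [neg_sq]
        rfl)

theorem quadrupole_sheet (i : Bool) (z : annulus ε) :
    quadrupole ε (sheet i z) = ((z : ℂ) ^ 2).re := rfl

theorem contDiff_re_sq : ContDiff ℝ ∞ fun z : ℂ => (z ^ 2).re :=
  Complex.reCLM.contDiff.comp (contDiff_id.pow 2)

theorem quadrupole_mem : quadrupole ε ∈ testFunctions ε := by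
  refine ⟨?_, fun i => ?_⟩
  · refine Continuous.quotient_lift (Continuous.quotient_lift ?_ _) _
    fun_prop
  · refine contDiff_re_sq.contDiffOn.congr fun z hz => ?_
    rw [pullback_apply _ _ hz, quadrupole_sheet]

theorem one_mem : (1 : MobiusBand ε → ℝ) ∈ testFunctions ε := by
  refine ⟨continuous_const, fun i => ?_⟩
  refine (contDiffOn_const (c := (1 : ℝ))).congr fun z hz => ?_
  rw [pullback_apply _ _ hz, Pi.one_apply]

theorem pullback_combination (a b : ℝ) {z : ℂ} (hz : z ∈ annulus ε) :
    pullback false (a • 1 + b • quadrupole ε) z = a + b * (z ^ 2).re := by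
  rw [pullback_apply _ _ hz]
  simp [quadrupole_sheet]

theorem energy_combination_le (a b : ℝ) :
    dirichletEnergy (a • 1 + b • quadrupole ε) ≤
      ENNReal.ofReal (4 * b ^ 2) * volume (openAnnulus ε) := by
  rw [← setLIntegral_const]
  refine setLIntegral_mono' (isOpen_openAnnulus ε).measurableSet fun z hz => ?_
  refine ENNReal.ofReal_le_ofReal ?_
  have d : HasFDerivAt (fun w : ℂ => a + b * (w ^ 2).re)
      (b • Complex.reCLM.comp ((2 * z) • ContinuousLinearMap.id ℂ ℂ |>.restrictScalars ℝ)) z := by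
    have h1 : HasFDerivAt (fun w : ℂ => w ^ 2)
        ((2 * z) • ContinuousLinearMap.id ℂ ℂ) z := by
      refine (hasDerivAt_pow 2 z).hasFDerivAt.congr_fderiv ?_
      ext
      simp
    exact ((Complex.reCLM.hasFDerivAt.comp z (h1.restrictScalars ℝ)).const_mul b).const_add a
  have e : pullback false (a • 1 + b • quadrupole ε) =ᶠ[𝓝 z] fun w : ℂ => a + b * (w ^ 2).re := by
    filter_upwards [(isOpen_openAnnulus ε).mem_nhds hz] with w hw
    exact pullback_combination a b (openAnnulus_subset ε hw)
  have n : ‖gradient (pullback false (a • 1 + b • quadrupole ε)) z‖ ≤ 2 * |b| := by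
    rw [gradient, LinearIsometryEquiv.norm_map, (d.congr_of_eventuallyEq e).fderiv]
    refine ContinuousLinearMap.opNorm_le_bound _ (by positivity) fun w => ?_
    have h1 : |((2 * z) * w).re| ≤ 2 * ‖w‖ := by
      refine (Complex.abs_re_le_norm _).trans ?_
      rw [norm_mul, norm_mul, Complex.norm_ofNat]
      have := mul_le_mul_of_nonneg_right hz.2.le (norm_nonneg w)
      linarith
    calc _ = |b| * |((2 * z) * w).re| := by simp
      _ ≤ |b| * (2 * ‖w‖) := by gcongr
      _ = _ := by ring
  calc _ ≤ (2 * |b|) ^ 2 := by gcongr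
    _ = 4 * b ^ 2 := by rw [mul_pow, sq_abs]; norm_num

/-- On the unit circle the function is `a + b cos 2θ`, whose square integrates to `2πa² + πb²`. -/
theorem le_boundaryIntegral_combination (hε : 0 < ε) (hε1 : ε ≤ 1) (a b : ℝ) :
    ENNReal.ofReal (Real.pi * b ^ 2) ≤
      boundaryIntegral (fun p => (a • 1 + b • quadrupole ε : MobiusBand ε → ℝ) p ^ 2) := by
  have mem : a • 1 + b • quadrupole ε ∈ testFunctions ε :=
    add_mem (Submodule.smul_mem _ _ one_mem) (Submodule.smul_mem _ _ quadrupole_mem)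
  rw [boundaryIntegral_sq mem hε hε1]
  refine ENNReal.ofReal_le_ofReal ?_
  have p : ∀ θ, pullback false (a • 1 + b • quadrupole ε) (circleMap 0 1 θ) ^ 2 =
      (a ^ 2 + b ^ 2 / 2) + 2 * a * b * Real.cos (2 * θ) + b ^ 2 / 2 * Real.cos (4 * θ) := by
    intro θ
    rw [pullback_combination a b (circleMap_mem_annulus hε hε1 le_rfl θ)]
    have : ((circleMap 0 1 θ) ^ 2).re = Real.cos (2 * θ) := by
      rw [circleMap_zero, Complex.ofReal_one, one_mul, ← Complex.exp_nat_mul]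
      have : ((2 : ℕ) : ℂ) * (θ * Complex.I) = ((2 * θ : ℝ) : ℂ) * Complex.I := by
        push_cast; ring
      rw [this, Complex.exp_ofReal_mul_I_re]
    rw [this, show 4 * θ = 2 * (2 * θ) by ring, Real.cos_two_mul (2 * θ)]
    ring
  simp_rw [p]
  have c1 : ∫ θ in 0..2 * Real.pi, Real.cos (2 * θ) = 0 := by
    rw [intervalIntegral.integral_comp_mul_left _ two_ne_zero, integral_cos,
      show 2 * (2 * Real.pi) = (4 : ℕ) * Real.pi by push_cast; ring, Real.sin_nat_mul_pi]
    simp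
  have c2 : ∫ θ in 0..2 * Real.pi, Real.cos (4 * θ) = 0 := by
    rw [intervalIntegral.integral_comp_mul_left _ four_ne_zero, integral_cos,
      show 4 * (2 * Real.pi) = (8 : ℕ) * Real.pi by push_cast; ring, Real.sin_nat_mul_pi]
    simp
  rw [intervalIntegral.integral_add, intervalIntegral.integral_add,
    intervalIntegral.integral_const_mul, intervalIntegral.integral_const_mul, c1, c2,
    intervalIntegral.integral_const, smul_eq_mul]
  · nlinarith [mul_nonneg Real.pi_pos.le (sq_nonneg a)]
  all_goals exact Continuous.intervalIntegrable (by fun_prop) _ _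

theorem linearIndependent_one_quadrupole (hε1 : ε ≤ 1) :
    LinearIndependent ℝ ![1, quadrupole ε] := by
  rw [LinearIndependent.pair_iff]
  intro a b h
  have h1 : (1 : ℂ) ∈ annulus ε := by simp [annulus, hε1]
  have hI : Complex.I ∈ annulus ε := by simp [annulus, hε1]
  have e1 := pullback_combination a b h1
  have eI := pullback_combination a b hI
  rw [pullback_apply _ _ h1, h] at e1
  rw [pullback_apply _ _ hI, h] at eI
  simp at e1 eI
  constructor <;> linarith

/-- On the span of `1` and `Re z²`, the energy is at most, and the boundary integral at least, a
multiple of `b²`, so the Rayleigh quotients are uniformly bounded. -/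
theorem steklovEigenvalue_lt_top (hε : 0 < ε) (hε1 : ε ≤ 1) : steklovEigenvalue ε 1 < ⊤ := by
  have hvol : volume (openAnnulus ε) < ⊤ := by
    refine (measure_mono fun z hz => ?_).trans_lt (measure_ball_lt_top (x := (0 : ℂ)) (r := 1))
    simpa using hz.2
  have hC : ENNReal.ofReal (4 / Real.pi) * volume (openAnnulus ε) < ⊤ :=
    ENNReal.mul_lt_top ENNReal.ofReal_lt_top hvol
  refine lt_of_le_of_lt ?_ hC
  refine iInf_le_of_le (Submodule.span ℝ (range ![1, quadrupole ε])) ?_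
  refine iInf_le_of_le ?_ (iInf_le_of_le ?_ ?_)
  · rw [Submodule.span_le, Matrix.range_cons, Matrix.range_cons, Matrix.range_empty]
    rintro φ (rfl | rfl | h)
    · exact one_mem
    · exact quadrupole_mem
    · exact h.elim
  · rw [finrank_span_eq_card (linearIndependent_one_quadrupole hε1)]
    rfl
  · refine iSup_le fun φ => iSup_le fun hφ => iSup_le fun _ => ?_
    rw [Matrix.range_cons, Matrix.range_cons, Matrix.range_empty, union_empty,
      singleton_union, Submodule.mem_span_pair] at hφ
    obtain ⟨a, b, rfl⟩ := hφ
    refine ENNReal.div_le_of_le_mul ?_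
    calc _ ≤ ENNReal.ofReal (4 * b ^ 2) * volume (openAnnulus ε) := energy_combination_le a b
      _ = ENNReal.ofReal (4 / Real.pi) * volume (openAnnulus ε) *
          ENNReal.ofReal (Real.pi * b ^ 2) := by
        rw [mul_right_comm, ← ENNReal.ofReal_mul (by positivity)]
        congr 2
        field_simp
      _ ≤ _ := by
        gcongr
        exact le_boundaryIntegral_combination hε hε1 a b

end FlatMobius

end

theorem mainTheorem10 :
    ∃ ε₀ : ℝ, 0 < ε₀ ∧ ε₀ < 1 ∧ ∀ ε : ℝ, 0 < ε → ε < ε₀ →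
      ENNReal.ofReal (2 * Real.pi) < FlatMobius.normalizedSteklovEigenvalue ε 1 ∧
        FlatMobius.normalizedSteklovEigenvalue ε 1 < ⊤ := by
  -- The threshold `1 / 2` is a convenient choice that makes `steklovBound_le` hold.
  refine ⟨1 / 2, by norm_num, by norm_num, fun ε hε hε1 => ?_⟩
  have h1 : ε ≤ 1 := by linarith
  rw [FlatMobius.normalizedSteklovEigenvalue, FlatMobius.boundaryLength_eq hε h1]
  refine ⟨?_, ENNReal.mul_lt_top (FlatMobius.steklovEigenvalue_lt_top hε h1)
    ENNReal.ofReal_lt_top⟩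
  have hb := FlatMobius.one_lt_steklovBound hε hε1
  calc ENNReal.ofReal (2 * Real.pi)
      < ENNReal.ofReal (FlatMobius.steklovBound ε * (2 * Real.pi)) := by
        rw [ENNReal.ofReal_lt_ofReal_iff (by positivity)]
        nlinarith [Real.pi_pos]
    _ = ENNReal.ofReal (FlatMobius.steklovBound ε) * ENNReal.ofReal (2 * Real.pi) :=
        ENNReal.ofReal_mul (by positivity)
    _ ≤ _ := mul_le_mul_left (FlatMobius.steklovBound_le_steklovEigenvalue hε hε1) _
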